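/- Let $M$ be a compact (Hausdorff) two-dimensional topological manifold without boundary and let $f\colon M\to M$ be an inner mapping, i.e. a continuous, open, surjective map such that the preimage of every point is a discrete set. A point $x\in M$ is called singular if $f$ is not a local homeomorphism at $x$. An open set $U\subset M$ is called strictly attracting if $f(\overline U)\subset U$; it generates the attractor $A=\bigcap_{n\ge 0} f^n(U)$, the basin $B_A=\bigcup_{n\ge 0} f^{-n}(U)$, and the region of strict wandering $D=B_A\setminus\bigcup_{n\ge 0} f^{-n}(A)$. Suppose that $S=D$ is connected and totally invariant, i.e. $f^{-1}(S)=S$. Such an $S$ is called a Pseudo-Böttcher component if there is a strictly attracting open set $U_0$ such that 1. $A=\bigcap_{n\ge 0} f^n(U_0)$; 2. $V_0=U_0\setminus A$ is connected; 3. $V_0$ contains no singular points of $f$; 4. there is a continuous function $\tau_0\colon V_0\to(-\infty,0)$ such that (i) $\tau_0$ is a trivial fiber bundle with fiber the circle $S^1$; (ii) for all $x\in V_0$ and all integers $n\ge 0$, $f^n(x)\in V_0$ and $\tau_0(f^n(x))=\tau_0(x)-n$; (iii) $\tau_0$ is constant on neutral sections: if $x,y\in V_0$ and $f^n(x)=f^n(y)$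 for some $n\ge 0$, then $\tau_0(x)=\tau_0(y)$. Let $S$ be a Pseudo-Böttcher component of $f$. If $S$ contains no singular points of $f$, then $S$ is homeomorphic to an open annulus. -/

import Mathlib

namespace InnerDynamics

variable {M : Type*} [TopologicalSpace M]

/-- An inner mapping: a continuous, open, discrete, surjective self-map. -/
structure IsInnerMapping (f : M → M) : Prop where
  continuous : Continuous f
  isOpenMap : IsOpenMap f
  discrete : ∀ y : M, IsDiscrete (f ⁻¹' {y})
  surjective : Function.Surjective f

/-- The set of singular points of `f`: the points at which `f` is not a local homeomorphism. -/
def singularSet (f : M → M) : Set M :=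
  {x | ¬ IsLocalHomeomorphOn f {x}}

/-- A set `X` is totally invariant if its full preimage is `X`. -/
def IsTotallyInvariant (f : M → M) (X : Set M) : Prop :=
  f ⁻¹' X = X

/-- An open set whose closure is mapped into it. -/
def IsStrictlyAttracting (f : M → M) (U : Set M) : Prop :=
  IsOpen U ∧ f '' closure U ⊆ U

/-- The attractor generated by `U`. -/
def attractor (f : M → M) (U : Set M) : Set M :=
  ⋂ n : ℕ, f^[n] '' U

/-- The basin of attraction generated by `U`. -/
def basin (f : M → M) (U : Set M) : Set M :=
  ⋃ n : ℕ, f^[n] ⁻¹' U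

/-- The region of strict wandering of the attractor generated by `U`: the basin of attraction
without all the iterated preimages of the attractor. -/
def strictWanderingRegion (f : M → M) (U : Set M) : Set M :=
  basin f U \ ⋃ n : ℕ, f^[n] ⁻¹' attractor f U

/-- The neutral section of `x`: all `y` with `fⁿ y = fⁿ x` for some `n ≥ 0`. -/
def neutralSection (f : M → M) (x : M) : Set M :=
  ⋃ n : ℕ, f^[n] ⁻¹' {f^[n] x}

/-- The conditions on `τ₀ : V₀ → (-∞, 0)`. The existential in `shift` records that `V₀` is
forward invariant, so that `τ₀ (fⁿ x)` makes sense. -/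
structure IsLevelFunction (f : M → M) (V₀ : Set M) (τ₀ : V₀ → Set.Iio (0 : ℝ)) : Prop where
  continuous : Continuous τ₀
  trivial_bundle : IsHomeomorphicTrivialFiberBundle Circle τ₀
  shift : ∀ (x : V₀) (n : ℕ), ∃ h : f^[n] (x : M) ∈ V₀,
    (τ₀ ⟨f^[n] (x : M), h⟩ : ℝ) = (τ₀ x : ℝ) - n
  const_neutral : ∀ x y : V₀, (y : M) ∈ neutralSection f (x : M) → τ₀ y = τ₀ x

/-- `S` is a (totally invariant) Pseudo-Böttcher component of `f`: it is the region of strict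
wandering of the attractor `A` generated by some strictly attracting `U`, it is connected and
totally invariant, and `A` is also generated by a strictly attracting `U₀` such that `U₀ \ A` is
connected, free of singular points, and carries a level function. -/
def IsPseudoBottcher (f : M → M) (S : Set M) : Prop :=
  ∃ U : Set M, IsStrictlyAttracting f U ∧
    S = strictWanderingRegion f U ∧ IsConnected S ∧ IsTotallyInvariant f S ∧
    ∃ U₀ : Set M, IsStrictlyAttracting f U₀ ∧ attractor f U₀ = attractor f U ∧
      IsConnected (U₀ \ attractor f U) ∧
      Disjoint (U₀ \ attractor f U) (singularSet f) ∧
      ∃ τ₀ : ↥(U₀ \ attractor f U) → Set.Iio (0 : ℝ),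
        IsLevelFunction f (U₀ \ attractor f U) τ₀

/-- The standard open annulus in the plane. -/
def openAnnulus : Set ℂ :=
  {z | 1 < ‖z‖ ∧ ‖z‖ < 2}

end InnerDynamics

/-! Let `F` be `f` restricted to `S`. It is a closed local homeomorphism with finite fibers, so
every iterate `F^[n]` is a finite covering of `S` by itself. Every orbit in `S` enters the annulus
`V = U₀ \ A`, so `τ₀` extends to `τ : S → ℝ` with `τ ∘ F = τ - 1` (`exists_extension_of_shift`), and
`S` is the increasing union of the sets `F^[n] ⁻¹' V`.

Once `V = {τ < 0}` is known (`eq_sublevel_of_isPreconnected`), these sets are the sublevels `{τ <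
n}`. They are connected, because a path in `S` lies in one of them and can be pushed to lower levels
through a lift of the universal covering of the annulus. A connected finite covering of an annulus
is an annulus, with the same level coordinate (`exists_homeomorph_circle_prod_of_isCoveringMap`).
Matching the angular coordinates of successive sublevels glues them into `Circle × ℝ`
(`exists_homeomorph_of_circleChart`). -/

namespace InnerDynamics

open Set Topology

/-! ### Finite coverings of an annulus. -/

section AnnulusCovering

/-- Two open quotient maps with the same fibers have homeomorphic targets. -/
theorem IsOpenQuotientMap.exists_homeomorph {A X Y : Type*} [TopologicalSpace A]
    [TopologicalSpace X] [TopologicalSpace Y] {f : A → X} {g : A → Y} (hf : IsOpenQuotientMap f)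
    (hg : IsOpenQuotientMap g) (h : ∀ a b, f a = f b ↔ g a = g b) :
    ∃ e : X ≃ₜ Y, ∀ a, e (f a) = g a := by
  have hu : ∀ a, g (Function.surjInv hf.surjective (f a)) = g a := fun a ↦
    (h _ _).1 (Function.surjInv_eq hf.surjective _)
  have hv : ∀ a, f (Function.surjInv hg.surjective (g a)) = f a := fun a ↦
    (h _ _).2 (Function.surjInv_eq hg.surjective _)
  refine ⟨{ toFun := fun x ↦ g (Function.surjInv hf.surjective x)
            invFun := fun y ↦ f (Function.surjInv hg.surjective y)
            left_inv := fun x ↦ (hv _).trans (Function.surjInv_eq _ _)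
            right_inv := fun y ↦ (hu _).trans (Function.surjInv_eq _ _)
            continuous_toFun := hf.continuous_comp_iff.1 ?_
            continuous_invFun := hg.continuous_comp_iff.1 ?_ }, hu⟩
  · exact hg.continuous.congr fun a ↦ (hu a).symm
  · exact hf.continuous.congr fun a ↦ (hv a).symm

variable {E B : Type*} [TopologicalSpace E] [TopologicalSpace B] {p : E → Circle × B}

/-- A covering map onto `Circle × B` lifts along the universal covering `ℝ × B → Circle × B`. -/
theorem exists_lift_circle_exp_prod [ContractibleSpace B] [LocallyPathConnectedSpace B]
    (hp : IsCoveringMap p) (e₀ : E) :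
    ∃ q : C(ℝ × B, E), (∀ a, p (q a) = (Circle.exp a.1, a.2)) ∧ ∃ a, q a = e₀ := by
  obtain ⟨r, hr⟩ : ∃ r, Circle.exp r = (p e₀).1 := Circle.exp_surjective _
  obtain ⟨q, ⟨h0, hq⟩, -⟩ := hp.existsUnique_continuousMap_lifts
    (⟨fun a : ℝ × B ↦ (Circle.exp a.1, a.2), by fun_prop⟩ : C(ℝ × B, Circle × B))
    (r, (p e₀).2) e₀ (by simp [hr])
  exact ⟨q, fun a ↦ congrFun hq a, _, h0⟩

/-- A lift of the universal covering reaches everything joined to a point of its range. -/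
theorem mem_range_lift_of_joined (hp : IsCoveringMap p) (q : C(ℝ × B, E))
    (hq : ∀ a, p (q a) = (Circle.exp a.1, a.2)) {x y : E} (hx : x ∈ range q)
    (hxy : Joined x y) : y ∈ range q := by
  obtain ⟨a, rfl⟩ := hx
  obtain ⟨γ⟩ := hxy
  have hc : Continuous fun t ↦ p (γ t) := hp.continuous.comp γ.continuous
  obtain ⟨δ, hδ, hδ0⟩ := Circle.isCoveringMap_exp.exists_path_lifts
    (⟨fun t ↦ (p (γ t)).1, hc.fst⟩ : C(unitInterval, Circle)) a.1 (by simp [hq])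
  have hδ' : ∀ t, Circle.exp (δ t) = (p (γ t)).1 := fun t ↦ congrFun hδ t
  -- Both sides lift the path `p ∘ γ` and agree at time `0`.
  have key : (fun t ↦ q (δ t, (p (γ t)).2)) = γ := by
    refine hp.eq_of_comp_eq (q.continuous.comp (δ.continuous.prodMk hc.snd))
      γ.continuous ?_ 0 ?_
    · funext t
      simp [hq, hδ']
    · simp [hq, hδ0]
  exact ⟨(δ 1, (p (γ 1)).2), by simpa using congrFun key 1⟩

/-- A path connected covering space of `Circle × B` with finite fibers is `Circle × B`. -/
theorem exists_homeomorph_circle_prod_of_isCoveringMap [ContractibleSpace B]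
    [LocallyPathConnectedSpace B] [PathConnectedSpace E]
    (hp : IsCoveringMap p) (hfin : ∀ b, (p ⁻¹' {b}).Finite) :
    ∃ g : E ≃ₜ Circle × B, ∀ e, (g e).2 = (p e).2 := by
  obtain ⟨e₀⟩ : Nonempty E := inferInstance
  obtain ⟨q, hq, a₀, ha₀⟩ := exists_lift_circle_exp_prod hp e₀
  have hsurj : Function.Surjective q := fun y ↦
    mem_range_lift_of_joined hp q hq ⟨a₀, rfl⟩ (PathConnectedSpace.joined _ y)
  have hpq : p ∘ q = Prod.map Circle.exp id := funext hq
  have hopen : IsOpenMap q := by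
    refine (IsLocalHomeomorph.of_comp (g := p) ?_ hp.isLocalHomeomorph q.continuous).isOpenMap
    rw [hpq]
    rintro ⟨r, b⟩
    obtain ⟨e, he, he'⟩ := Circle.isCoveringMap_exp.isLocalHomeomorph r
    refine ⟨e.prod (OpenPartialHomeomorph.refl B), by simpa using he, ?_⟩
    rw [he']
    rfl
  -- By uniqueness of lifts, a translation that preserves `q` at one point preserves it everywhere.
  have hper : ∀ (s : ℝ) (a : ℝ × B), Circle.exp s = 1 → q (a.1 + s, a.2) = q a →
      ∀ c : ℝ × B, q (c.1 + s, c.2) = q c := by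
    intro s a hs ha c
    refine congrFun (hp.eq_of_comp_eq (g₁ := fun c : ℝ × B ↦ q (c.1 + s, c.2)) (g₂ := q)
      (by fun_prop) q.continuous ?_ a ha) c
    funext c
    simp [hq, Circle.exp_add, hs]
  -- The periods of `q`, a subgroup of `2πℤ`; `E` will be the quotient of `ℝ × B` by `P`.
  let P : AddSubgroup ℝ :=
    { carrier := {s | Circle.exp s = 1 ∧ ∀ c : ℝ × B, q (c.1 + s, c.2) = q c}
      zero_mem' := by simp
      add_mem' := by
        rintro s t ⟨hs, hs'⟩ ⟨ht, ht'⟩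
        refine ⟨by simp [Circle.exp_add, hs, ht], fun c ↦ ?_⟩
        have := ht' (c.1 + s, c.2)
        rw [← add_assoc]
        exact this.trans (hs' c)
      neg_mem' := by
        rintro s ⟨hs, hs'⟩
        refine ⟨by simp [Circle.exp_neg, hs], fun c ↦ ?_⟩
        have := hs' (c.1 + -s, c.2)
        simpa using this.symm }
  have hP : ∀ s ∈ P, ∃ n : ℤ, s = n * (2 * Real.pi) := fun s hs ↦ Circle.exp_eq_one.1 hs.1
  -- Pigeonhole: `q` sends the infinitely many points `(2πn, a₀.2)` into one finite fiber of `p`.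
  obtain ⟨s, hsP, hs0⟩ : ∃ s ∈ P, s ≠ 0 := by
    have hmaps : MapsTo (fun n : ℤ ↦ q (n * (2 * Real.pi), a₀.2)) univ (p ⁻¹' {(1, a₀.2)}) := by
      intro n _
      have : Circle.exp (n * (2 * Real.pi)) = 1 := Circle.exp_eq_one.2 ⟨n, rfl⟩
      simp [hq, this]
    obtain ⟨m, -, n, -, hmn, h⟩ := infinite_univ.exists_ne_map_eq_of_mapsTo hmaps (hfin _)
    have he : Circle.exp (((n : ℝ) - m) * (2 * Real.pi)) = 1 :=
      Circle.exp_eq_one.2 ⟨n - m, by push_cast; ring⟩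
    refine ⟨((n : ℝ) - m) * (2 * Real.pi),
      ⟨he, hper _ ((m : ℝ) * (2 * Real.pi), a₀.2) he ?_⟩, ?_⟩
    · rw [← add_mul, add_sub_cancel]
      exact h.symm
    · exact mul_ne_zero (sub_ne_zero.2 (by exact_mod_cast hmn.symm)) (by positivity)
  -- A dense subgroup would meet `(0, 2π)`, which contains no multiple of `2π`.
  obtain ⟨T, hT⟩ : ∃ T, P = AddSubgroup.zmultiples T := by
    rcases AddSubgroup.dense_or_cyclic P with h | ⟨T, hT⟩
    · obtain ⟨t, ⟨h1, h2⟩, ht⟩ := h.inter_open_nonempty (Ioo 0 (2 * Real.pi)) isOpen_Ioo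
        (nonempty_Ioo.2 (by positivity))
      obtain ⟨n, rfl⟩ := hP t ht
      have hpi : 0 < 2 * Real.pi := by positivity
      have h3 : (0 : ℝ) < n := pos_of_mul_pos_left h1 hpi.le
      have h4 : (n : ℝ) < 1 := by nlinarith
      norm_cast at h3 h4
      omega
    · exact ⟨T, by rw [hT, AddSubgroup.zmultiples_eq_closure]⟩
  have hT0 : T ≠ 0 := by
    rintro rfl
    rw [hT] at hsP
    simp at hsP
    exact hs0 hsP
  have heq : ∀ a c : ℝ × B, q a = q c ↔
      Prod.map ((↑) : ℝ → AddCircle T) id a = Prod.map ((↑) : ℝ → AddCircle T) id c := by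
    intro a c
    have hmem : (a.1 : AddCircle T) = c.1 ↔ -a.1 + c.1 ∈ P := by
      rw [hT]
      exact QuotientAddGroup.eq
    rw [Prod.ext_iff, Prod.map_fst, Prod.map_fst, Prod.map_snd, Prod.map_snd, hmem, id, id]
    constructor
    · intro h
      have h1 : Circle.exp a.1 = Circle.exp c.1 ∧ a.2 = c.2 := by
        have := congrArg p h
        simpa [hq] using this
      have h2 : Circle.exp (-a.1 + c.1) = 1 := by
        rw [Circle.exp_add, Circle.exp_neg, h1.1, inv_mul_cancel]
      refine ⟨⟨h2, hper _ a h2 ?_⟩, h1.2⟩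
      rw [add_neg_cancel_left, h1.2]
      exact h.symm
    · rintro ⟨h1, h2⟩
      have := h1.2 a
      rw [add_neg_cancel_left, h2] at this
      exact this.symm
  have hmk : IsOpenQuotientMap ((↑) : ℝ → AddCircle T) :=
    ⟨QuotientAddGroup.mk_surjective, continuous_quotient_mk', QuotientAddGroup.isOpenMap_coe⟩
  obtain ⟨g, hg⟩ := IsOpenQuotientMap.exists_homeomorph ⟨hsurj, q.continuous, hopen⟩
    (hmk.prodMap (IsOpenQuotientMap.id (X := B))) heq
  refine ⟨g.trans ((AddCircle.homeomorphCircle hT0).prodCongr (Homeomorph.refl B)), fun e ↦ ?_⟩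
  obtain ⟨a, rfl⟩ := hsurj e
  simp [hg, hq]

/-- Points of a covering space of `Circle × Iio 0` which are joined and lie below a level `c` lie
in a common connected set below the level `c`. -/
theorem exists_isPreconnected_of_joined {p : E → Circle × Iio (0 : ℝ)} (hp : IsCoveringMap p)
    {x y : E} (hxy : Joined x y) {c : ℝ} (hx : ((p x).2 : ℝ) < c) (hy : ((p y).2 : ℝ) < c) :
    ∃ t : Set E, IsPreconnected t ∧ x ∈ t ∧ y ∈ t ∧ ∀ z ∈ t, ((p z).2 : ℝ) < c := by
  have : ContractibleSpace (Iio (0 : ℝ)) := (convex_Iio 0).contractibleSpace ⟨-1, by simp⟩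
  have : LocallyPathConnectedSpace (Iio (0 : ℝ)) := isOpen_Iio.locallyPathConnectedSpace
  obtain ⟨q, hq, a, rfl⟩ := exists_lift_circle_exp_prod hp x
  obtain ⟨b, rfl⟩ := mem_range_lift_of_joined hp q hq ⟨a, rfl⟩ hxy
  rw [hq] at hx hy
  have hpre : IsPreconnected {s : Iio (0 : ℝ) | (s : ℝ) < c} := by
    have : OrdConnected {s : Iio (0 : ℝ) | (s : ℝ) < c} :=
      ⟨fun s _ t ht u hu ↦ lt_of_le_of_lt (Subtype.coe_le_coe.2 hu.2) (mem_ofPred.1 ht)⟩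
    have h2 : ((↑) : Iio (0 : ℝ) → ℝ) '' {s : Iio (0 : ℝ) | (s : ℝ) < c} = Iio 0 ∩ Iio c := by
      ext r
      simp [and_comm]
    rw [← Topology.IsInducing.subtypeVal.isPreconnected_image, h2]
    exact ((convex_Iio 0).inter (convex_Iio c)).isPreconnected
  refine ⟨q '' (univ ×ˢ {s : Iio (0 : ℝ) | (s : ℝ) < c}),
    (isPreconnected_univ.prod hpre).image _ q.continuous.continuousOn,
    mem_image_of_mem _ ⟨trivial, hx⟩, mem_image_of_mem _ ⟨trivial, hy⟩, ?_⟩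
  rintro _ ⟨z, hz, rfl⟩
  rw [hq]
  exact hz.2

end AnnulusCovering

/-! ### Gluing annular charts over an exhaustion. -/

section Gluing

variable {X : Type*} [TopologicalSpace X]

/-- A trivialization of `τ : X → ℝ` with fiber `Circle` over `(-∞, c)`. -/
structure CircleChart (τ : X → ℝ) (c : ℝ) where
  /-- the angular coordinate -/
  angle : X → Circle
  /-- the inverse of the chart -/
  point : Circle × ℝ → X
  continuousOn_angle : ContinuousOn angle {x | τ x < c}
  continuousOn_point : ContinuousOn point {a | a.2 < c}
  level_point : ∀ a, a.2 < c → τ (point a) = a.2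
  angle_point : ∀ a, a.2 < c → angle (point a) = a.1
  point_angle : ∀ x, τ x < c → point (angle x, τ x) = x

variable {τ : X → ℝ} {b c : ℝ}

/-- The chart obtained from `C'` by rotating the circles so that it agrees with `C` up to the
level `c - 1`. -/
def CircleChart.adjust (C : CircleChart τ b) (C' : CircleChart τ c) (hτ : Continuous τ)
    (hbc : b ≤ c) : CircleChart τ c where
  -- Slide along the constant-angle line of `C'` down to level at most `b - 1`, inside the domain of
  -- `C`, and read the angle there. Above `b - 1` the change of angle is frozen.
  angle x := C.angle (C'.point (C'.angle x, min (τ x) (b - 1)))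
  point a := C'.point (C'.angle (C.point (a.1, min a.2 (b - 1))), a.2)
  continuousOn_angle := by
    have hlt : ∀ x, min (τ x) (b - 1) < b := fun x ↦
      lt_of_le_of_lt (min_le_right _ _) (by linarith)
    refine C.continuousOn_angle.comp (C'.continuousOn_point.comp
      (C'.continuousOn_angle.prodMk (by fun_prop)) fun x _ ↦ (hlt x).trans_le hbc) fun x _ ↦ ?_
    change τ (C'.point _) < b
    rw [C'.level_point _ ((hlt x).trans_le hbc)]
    exact hlt x
  continuousOn_point := by
    have hlt : ∀ a : Circle × ℝ, min a.2 (b - 1) < b := fun a ↦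
      lt_of_le_of_lt (min_le_right _ _) (by linarith)
    refine C'.continuousOn_point.comp ((C'.continuousOn_angle.comp (C.continuousOn_point.comp
      (by fun_prop) fun a _ ↦ hlt a) fun a _ ↦ ?_).prodMk (by fun_prop)) fun a ha ↦ ha
    change τ (C.point _) < c
    rw [C.level_point _ (hlt a)]
    exact (hlt a).trans_le hbc
  level_point a ha := C'.level_point _ ha
  angle_point a ha := by
    have hlt : min a.2 (b - 1) < b := lt_of_le_of_lt (min_le_right _ _) (by linarith)
    have h := C'.point_angle (C.point (a.1, min a.2 (b - 1)))
    rw [C.level_point _ hlt] at h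
    have hl := C'.level_point (C'.angle (C.point (a.1, min a.2 (b - 1))), a.2) ha
    have hu := C'.angle_point (C'.angle (C.point (a.1, min a.2 (b - 1))), a.2) ha
    dsimp only at hl hu h ⊢
    rw [hl, hu, h (hlt.trans_le hbc), C.angle_point _ hlt]
  point_angle x hx := by
    have hlt : min (τ x) (b - 1) < b := lt_of_le_of_lt (min_le_right _ _) (by linarith)
    have h := C.point_angle (C'.point (C'.angle x, min (τ x) (b - 1)))
    rw [C'.level_point _ (hlt.trans_le hbc)] at h
    dsimp only at h ⊢
    rw [h hlt, C'.angle_point _ (hlt.trans_le hbc), C'.point_angle _ hx]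

theorem CircleChart.adjust_angle (C : CircleChart τ b) (C' : CircleChart τ c) (hτ : Continuous τ)
    (hbc : b ≤ c) {x : X} (hx : τ x ≤ b - 1) : (C.adjust C' hτ hbc).angle x = C.angle x := by
  have h : min (τ x) (b - 1) = τ x := min_eq_left hx
  simp only [CircleChart.adjust]
  rw [h, C'.point_angle _ (by linarith)]

theorem CircleChart.adjust_point (C : CircleChart τ b) (C' : CircleChart τ c) (hτ : Continuous τ)
    (hbc : b ≤ c) {a : Circle × ℝ} (ha : a.2 ≤ b - 1) :
    (C.adjust C' hτ hbc).point a = C.point a := by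
  have h : min a.2 (b - 1) = a.2 := min_eq_left ha
  have h' := C'.point_angle (C.point a)
  rw [C.level_point a (by linarith)] at h'
  simp only [CircleChart.adjust]
  rw [h, h' (by linarith)]

/-- Charts over all the half-lines `(-∞, n)` glue to a global trivialization. -/
theorem exists_homeomorph_of_circleChart (hτ : Continuous τ) (D : ∀ n : ℕ, CircleChart τ n) :
    Nonempty (X ≃ₜ Circle × ℝ) := by
  let C : ∀ n : ℕ, CircleChart τ n := fun n ↦
    Nat.rec (D 0) (fun n Cn ↦ Cn.adjust (D (n + 1)) hτ (by simp)) n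
  have hangle : ∀ (m n : ℕ) (x : X), m ≤ n → τ x ≤ m - 1 → (C n).angle x = (C m).angle x := by
    intro m n x hmn hx
    induction n, hmn using Nat.le_induction with
    | base => rfl
    | succ n hmn ih =>
      have : (m : ℝ) ≤ n := by exact_mod_cast hmn
      exact ((C n).adjust_angle (D (n + 1)) hτ _ (by linarith)).trans ih
  have hpoint : ∀ (m n : ℕ) (a : Circle × ℝ), m ≤ n → a.2 ≤ m - 1 →
      (C n).point a = (C m).point a := by
    intro m n a hmn ha
    induction n, hmn using Nat.le_induction with
    | base => rfl
    | succ n hmn ih =>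
      have : (m : ℝ) ≤ n := by exact_mod_cast hmn
      exact ((C n).adjust_point (D (n + 1)) hτ _ (by linarith)).trans ih
  -- The extra `1` puts level `t` at or below `N t - 1`, where all later charts agree with `C (N
  -- t)`.
  let N : ℝ → ℕ := fun t ↦ ⌈t⌉₊ + 1
  have hN : ∀ t, t ≤ (N t : ℝ) - 1 := fun t ↦ by simpa [N] using Nat.le_ceil t
  have hN' : ∀ t, t < N t := fun t ↦ by linarith [hN t]
  have hle : ∀ (t : ℝ) (n : ℕ), t ≤ (n : ℝ) → N t ≤ n + 1 := fun t n h ↦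
    Nat.succ_le_succ (Nat.ceil_le.2 h)
  refine ⟨{ toFun := fun x ↦ ((C (N (τ x))).angle x, τ x)
            invFun := fun a ↦ (C (N a.2)).point a
            left_inv := fun x ↦ (C (N (τ x))).point_angle x (hN' _)
            right_inv := fun a ↦ ?_
            continuous_toFun := ?_
            continuous_invFun := ?_ }⟩
  · have h := (C (N a.2)).level_point a (hN' _)
    have h' := (C (N a.2)).angle_point a (hN' _)
    dsimp only
    rw [h, h']
  · refine Continuous.prodMk (continuous_iff_continuousAt.2 fun x ↦ ?_) hτ
    obtain ⟨n, hn⟩ := exists_nat_gt (τ x)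
    have hopen : {y | τ y < n} ∈ 𝓝 x := (isOpen_lt hτ continuous_const).mem_nhds hn
    have hc : ContinuousAt (C (n + 1)).angle x :=
      (C (n + 1)).continuousOn_angle.continuousAt ((isOpen_lt hτ continuous_const).mem_nhds
        (mem_ofPred.2 (by push_cast; linarith)))
    refine hc.congr (Filter.mem_of_superset hopen fun y hy ↦ ?_)
    exact hangle _ _ y (hle _ _ (le_of_lt hy)) (hN _)
  · refine continuous_iff_continuousAt.2 fun a ↦ ?_
    obtain ⟨n, hn⟩ := exists_nat_gt a.2
    have hopen : {y : Circle × ℝ | y.2 < n} ∈ 𝓝 a :=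
      (isOpen_lt continuous_snd continuous_const).mem_nhds hn
    have hc : ContinuousAt (C (n + 1)).point a :=
      (C (n + 1)).continuousOn_point.continuousAt
        ((isOpen_lt continuous_snd continuous_const).mem_nhds
          (mem_ofPred.2 (by push_cast; linarith)))
    refine hc.congr (Filter.mem_of_superset hopen fun y hy ↦ ?_)
    exact hpoint _ _ y (hle _ _ (le_of_lt hy)) (hN _)

/-- A homeomorphism between a sublevel set of `τ` and `Circle × Iio 0` which respects the levels
is a chart. -/
theorem nonempty_circleChart_of_homeomorph {W : Set X} (hW : W = {x | τ x < c})
    (g : W ≃ₜ Circle × Iio (0 : ℝ)) (hg : ∀ x : W, ((g x).2 : ℝ) = τ x - c) :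
    Nonempty (CircleChart τ c) := by
  subst hW
  have hneg : ∀ {t : ℝ}, t < c → t - c ∈ Iio (0 : ℝ) := fun h ↦ sub_neg.2 h
  -- The values outside the domain are arbitrary and only make the maps total.
  refine ⟨{ angle := fun x ↦ if h : τ x < c then (g ⟨x, h⟩).1 else 1
            point := fun a ↦ if h : a.2 < c then (g.symm (a.1, ⟨a.2 - c, hneg h⟩) : X)
              else g.symm (1, ⟨-1, by simp⟩)
            continuousOn_angle := ?_
            continuousOn_point := ?_
            level_point := fun a ha ↦ ?_
            angle_point := fun a ha ↦ ?_
            point_angle := fun x hx ↦ ?_ }⟩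
  · rw [continuousOn_iff_continuous_domRestrict]
    convert g.continuous.fst using 1
    funext x
    exact dif_pos x.2
  · rw [continuousOn_iff_continuous_domRestrict]
    have : Continuous fun a : {a : Circle × ℝ | a.2 < c} ↦
        (g.symm (a.1.1, ⟨a.1.2 - c, hneg a.2⟩) : X) := by fun_prop
    convert this using 1
    funext a
    exact dif_pos a.2
  · rw [dif_pos ha]
    have := hg (g.symm (a.1, ⟨a.2 - c, hneg ha⟩))
    rw [g.apply_symm_apply] at this
    simpa using this.symm
  · have h : τ (g.symm (a.1, ⟨a.2 - c, hneg ha⟩)) < c :=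
      (g.symm (a.1, ⟨a.2 - c, hneg ha⟩)).2
    rw [dif_pos ha, dif_pos h]
    simp
  · rw [dif_pos hx, dif_pos hx]
    have : ((g ⟨x, hx⟩).1, (⟨τ x - c, hneg hx⟩ : Iio (0 : ℝ))) = g ⟨x, hx⟩ :=
      Prod.ext rfl (Subtype.ext (hg ⟨x, hx⟩).symm)
    rw [this, g.symm_apply_apply]

end Gluing

/-! ### The cylinder as a planar annulus, with radius `1 + Real.sigmoid t`. -/

/-- The open cylinder is the open annulus. -/
theorem nonempty_circle_prod_real_homeomorph_openAnnulus :
    Nonempty (Circle × ℝ ≃ₜ openAnnulus) := by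
  have hr : ∀ t : ℝ, 0 < 1 + Real.sigmoid t := fun t ↦ by linarith [Real.sigmoid_pos t]
  have hnorm : ∀ a : Circle × ℝ,
      ‖((1 + Real.sigmoid a.2 : ℝ) : ℂ) * (a.1 : ℂ)‖ = 1 + Real.sigmoid a.2 := fun a ↦ by
    rw [norm_mul, Circle.norm_coe, mul_one, Complex.norm_real, Real.norm_of_nonneg (hr _).le]
  have hlow : ∀ w : openAnnulus, 0 < ‖(w : ℂ)‖ - 1 := fun w ↦ sub_pos.2 w.2.1
  have hne : ∀ w : openAnnulus, (‖(w : ℂ)‖ : ℂ) ≠ 0 := fun w ↦ by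
    exact_mod_cast (show ‖(w : ℂ)‖ ≠ 0 by linarith [hlow w])
  have hinv : ∀ w : openAnnulus, 0 < (‖(w : ℂ)‖ - 1)⁻¹ - 1 := fun w ↦
    sub_pos.2 ((one_lt_inv₀ (hlow w)).2 (by linarith [w.2.2]))
  have hcirc : ∀ w : openAnnulus, (w : ℂ) / ‖(w : ℂ)‖ ∈ Submonoid.unitSphere ℂ := fun w ↦ by
    refine mem_sphere_zero_iff_norm.2 ?_
    rw [norm_div, Complex.norm_real, norm_norm,
      div_self (by exact_mod_cast hne w)]
  refine ⟨{ toFun := fun a ↦ ⟨((1 + Real.sigmoid a.2 : ℝ) : ℂ) * a.1, ?_⟩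
            invFun := fun w ↦ (⟨(w : ℂ) / ‖(w : ℂ)‖, hcirc w⟩,
              -Real.log ((‖(w : ℂ)‖ - 1)⁻¹ - 1))
            left_inv := fun a ↦ Prod.ext (Circle.ext ?_) ?_
            right_inv := fun w ↦ Subtype.ext ?_
            continuous_toFun := ?_
            continuous_invFun := ?_ }⟩
  · refine ⟨?_, ?_⟩ <;> rw [hnorm] <;> linarith [Real.sigmoid_pos a.2, Real.sigmoid_lt_one a.2]
  · change ((1 + Real.sigmoid a.2 : ℝ) : ℂ) * (a.1 : ℂ) / _ = _
    rw [hnorm, mul_div_cancel_left₀]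
    exact_mod_cast (hr a.2).ne'
  · change -Real.log ((‖((1 + Real.sigmoid a.2 : ℝ) : ℂ) * (a.1 : ℂ)‖ - 1)⁻¹ - 1) = a.2
    rw [hnorm, Real.sigmoid_def]
    simp
  · have h : Real.sigmoid (-Real.log ((‖(w : ℂ)‖ - 1)⁻¹ - 1)) = ‖(w : ℂ)‖ - 1 := by
      rw [Real.sigmoid_def, neg_neg, Real.exp_log (hinv w), add_sub_cancel, inv_inv]
    change ((1 + Real.sigmoid (-Real.log ((‖(w : ℂ)‖ - 1)⁻¹ - 1)) : ℝ) : ℂ) *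
      ((w : ℂ) / ‖(w : ℂ)‖) = w
    rw [h, add_sub_cancel, mul_div_cancel₀ _ (hne w)]
  · refine Continuous.subtype_mk ?_ _
    have := _root_.continuous_sigmoid
    fun_prop
  · refine Continuous.prodMk (Continuous.subtype_mk ?_ _) ?_
    · exact continuous_subtype_val.div (by fun_prop) hne
    · refine (Continuous.log ?_ fun w ↦ (hinv w).ne').neg
      exact (Continuous.inv₀ (by fun_prop) fun w ↦ (hlow w).ne').sub continuous_const

/-! ### Extending the level function and exhausting by sublevels. -/

section Dynamics

variable {X : Type*} [TopologicalSpace X] {F : X → X} {V : Set X}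

/-- A continuous function on an absorbing open set which drops by one along `F` extends to the
whole space. -/
theorem exists_extension_of_shift (hF : Continuous F) (hV : IsOpen V) (hFV : MapsTo F V V)
    (habs : ∀ x, ∃ n, F^[n] x ∈ V) {σ : V → ℝ} (hσ : Continuous σ)
    (hshift : ∀ x : V, σ ⟨F x, hFV x.2⟩ = σ x - 1) :
    ∃ τ : X → ℝ, Continuous τ ∧ (∀ x : V, τ x = σ x) ∧ ∀ (n : ℕ) x, τ (F^[n] x) = τ x - n := by
  have hFn : ∀ (n : ℕ) {x : X}, x ∈ V → F^[n] x ∈ V := fun n _ hx ↦ hFV.iterate n hx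
  have hsh : ∀ (n : ℕ) (x : X) (hx : x ∈ V), σ ⟨F^[n] x, hFn n hx⟩ = σ ⟨x, hx⟩ - n := by
    intro n
    induction n with
    | zero => intro x hx; simp
    | succ n ih =>
      intro x hx
      have h := ih (F x) (hFV hx)
      have h' := hshift ⟨x, hx⟩
      simp only [Function.iterate_succ, Function.comp_apply]
      rw [h, h']
      push_cast
      ring
  let τ : X → ℝ := fun x ↦ σ ⟨F^[(habs x).choose] x, (habs x).choose_spec⟩ + (habs x).choose
  -- Any entry time gives the same value, so on the open set `F^[n] ⁻¹' V` the single exponent `n`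
  -- computes `τ`.
  have hwd : ∀ (m n : ℕ) (x : X) (hm : F^[m] x ∈ V) (hn : F^[n] x ∈ V),
      σ ⟨F^[m] x, hm⟩ + m = σ ⟨F^[n] x, hn⟩ + n := by
    have aux : ∀ (m k : ℕ) (x : X) (hm : F^[m] x ∈ V) (hn : F^[m + k] x ∈ V),
        σ ⟨F^[m] x, hm⟩ + m = σ ⟨F^[m + k] x, hn⟩ + (m + k : ℕ) := by
      intro m k x hm hn
      have h := hsh k _ hm
      have h2 : F^[m + k] x = F^[k] (F^[m] x) := by
        rw [add_comm, Function.iterate_add_apply]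
      simp only [h2, h]
      push_cast
      ring
    intro m n x hm hn
    rcases le_total m n with h | h
    · obtain ⟨k, rfl⟩ := Nat.exists_eq_add_of_le h
      exact aux m k x hm hn
    · obtain ⟨k, rfl⟩ := Nat.exists_eq_add_of_le h
      exact (aux n k x hn hm).symm
  have hτ : ∀ (n : ℕ) (x : X) (hx : F^[n] x ∈ V), τ x = σ ⟨F^[n] x, hx⟩ + n :=
    fun n x hx ↦ hwd _ _ x _ hx
  refine ⟨τ, continuous_iff_continuousAt.2 fun x ↦ ?_, fun x ↦ ?_, fun n x ↦ ?_⟩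
  · obtain ⟨n, hn⟩ := habs x
    have hopen : IsOpen (F^[n] ⁻¹' V) := hV.preimage (hF.iterate n)
    refine ContinuousOn.continuousAt ?_ (hopen.mem_nhds hn)
    rw [continuousOn_iff_continuous_domRestrict]
    have : Continuous fun y : F^[n] ⁻¹' V ↦ σ ⟨F^[n] y, y.2⟩ + n :=
      (hσ.comp (((hF.iterate n).comp continuous_subtype_val).subtype_mk _)).add continuous_const
    exact this.congr fun y ↦ (hτ n y y.2).symm
  · simpa using hτ 0 x x.2
  · obtain ⟨m, hm⟩ := habs x
    have h1 : F^[m + n] x = F^[m] (F^[n] x) := Function.iterate_add_apply ..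
    have h2 : F^[m + n] x ∈ V := by
      rw [add_comm, Function.iterate_add_apply]
      exact hFn n hm
    have h3 := hτ (m + n) x h2
    have h4 := hτ m (F^[n] x) (h1 ▸ h2)
    simp only [h1] at h3
    rw [h4, h3]
    push_cast
    ring

/-- An open annular end `V` of the levels below `0` is closed among those levels. -/
theorem eq_sublevel_of_isPreconnected [T2Space X] {τ : X → ℝ} (hτ : Continuous τ)
    (hV : IsOpen V) (e : V ≃ₜ Iio (0 : ℝ) × Circle) (he : ∀ x : V, ((e x).1 : ℝ) = τ x)
    (hconn : IsPreconnected {x | τ x < 0}) : V = {x | τ x < 0} := by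
  have hsub : V ⊆ {x | τ x < 0} := fun x hx ↦ by
    have := (e ⟨x, hx⟩).1.2
    rw [mem_Iio, he] at this
    exact this
  refine hsub.antisymm ?_
  have hne : (V ∩ {x | τ x < 0}).Nonempty := by
    let x : V := e.symm (⟨-1, by simp⟩, 1)
    exact ⟨x, x.2, hsub x.2⟩
  refine hconn.subset_of_closure_inter_subset hV (by rwa [inter_comm]) ?_
  rintro x ⟨hx, hx0⟩
  have hx0 : τ x < 0 := hx0
  -- A compact band of negative levels with `τ x` in its interior: the part of `V` over it is
  -- compact, hence closed in `X`, and contains the points of `V` near `x`.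
  let K : Set (Iio (0 : ℝ)) := {s | τ x - 1 ≤ s ∧ (s : ℝ) ≤ τ x / 2}
  have hK : IsCompact K := by
    rw [Topology.IsInducing.subtypeVal.isCompact_iff]
    have : ((↑) : Iio (0 : ℝ) → ℝ) '' K = Icc (τ x - 1) (τ x / 2) := by
      ext r
      constructor
      · rintro ⟨s, hs, rfl⟩
        exact hs
      · intro hr
        exact ⟨⟨r, lt_of_le_of_lt hr.2 (by linarith)⟩, hr, rfl⟩
    rw [this]
    exact isCompact_Icc
  have hL : IsCompact ((fun a ↦ (e.symm a : X)) '' (K ×ˢ (univ : Set Circle))) :=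
    (hK.prod isCompact_univ).image (by fun_prop)
  have hLV : (fun a ↦ (e.symm a : X)) '' (K ×ˢ (univ : Set Circle)) ⊆ V := by
    rintro _ ⟨a, -, rfl⟩
    exact (e.symm a).2
  have ho : IsOpen {y | τ x - 1 < τ y ∧ τ y < τ x / 2} :=
    (isOpen_lt continuous_const hτ).inter (isOpen_lt hτ continuous_const)
  have hcl : x ∈ closure ({y | τ x - 1 < τ y ∧ τ y < τ x / 2} ∩ V) :=
    ho.inter_closure ⟨⟨by linarith, by linarith⟩, hx⟩
  refine hLV (closure_minimal ?_ hL.isClosed hcl)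
  rintro y ⟨⟨hy1, hy2⟩, hy⟩
  refine ⟨e ⟨y, hy⟩, ⟨⟨?_, ?_⟩, trivial⟩, by simp⟩
  · rw [he]; exact hy1.le
  · rw [he]; exact hy2.le

/-- A connected space which is the union of the preimages of an open annulus under the iterates of
a finite covering, compatibly with a level function, is an open cylinder. -/
theorem nonempty_homeomorph_cylinder [T2Space X] [ConnectedSpace X] [LocallyPathConnectedSpace X]
    (hcl : IsClosedMap F) (hlh : IsLocalHomeomorph F) (hfin : ∀ x, (F ⁻¹' {x}).Finite)
    (hV : IsOpen V) (hFV : MapsTo F V V) (habs : ∀ x, ∃ n, F^[n] x ∈ V)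
    (e : V ≃ₜ Iio (0 : ℝ) × Circle)
    (he : ∀ x : V, ((e ⟨F x, hFV x.2⟩).1 : ℝ) = (e x).1 - 1) :
    Nonempty (X ≃ₜ Circle × ℝ) := by
  obtain ⟨τ, hτ, hτV, hτF⟩ := exists_extension_of_shift (σ := fun x ↦ ((e x).1 : ℝ))
    hlh.continuous hV hFV habs (by fun_prop) he
  have hcln : ∀ n, IsClosedMap F^[n] := fun n ↦ by
    induction n with
    | zero => exact IsClosedMap.id
    | succ n ih => exact ih.comp hcl
  have hlhn : ∀ n, IsLocalHomeomorph F^[n] := fun n ↦ by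
    induction n with
    | zero => exact (Homeomorph.refl X).isLocalHomeomorph
    | succ n ih => exact ih.comp hlh
  have hfinn : ∀ n x, (F^[n] ⁻¹' {x}).Finite := fun n ↦ by
    induction n with
    | zero => exact fun x ↦ finite_singleton x
    | succ n ih =>
      intro x
      rw [Function.iterate_succ, preimage_comp]
      exact (ih x).preimage' fun y _ ↦ hfin y
  have hcov : ∀ n, IsCoveringMap F^[n] := fun n ↦ by
    rw [isCoveringMap_iff_isCoveringMapOn_univ]
    exact (hcln n).isCoveringMapOn_of_isLocalHomeomorphOn (fun x _ ↦ hfinn n x)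
      ((hlhn n).isLocalHomeomorphOn.mono (subset_univ _))
  let p : ∀ n, F^[n] ⁻¹' V → Circle × Iio (0 : ℝ) := fun n ↦
    (e.trans (Homeomorph.prodComm _ _)) ∘ V.restrictPreimage F^[n]
  have hp : ∀ n, IsCoveringMap (p n) := fun n ↦ ((hcov n).restrictPreimage V).homeomorph_comp _
  have hp2 : ∀ n (x : F^[n] ⁻¹' V), ((p n x).2 : ℝ) = τ x - n := fun n x ↦ by
    rw [← hτF]
    exact (hτV ⟨F^[n] x, x.2⟩).symm
  have hpfin : ∀ n b, (p n ⁻¹' {b}).Finite := by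
    intro n b
    refine ((hfinn n (e.symm b.swap)).preimage
      (f := ((↑) : F^[n] ⁻¹' V → X)) Subtype.val_injective.injOn).subset ?_
    rintro x rfl
    simp [p]
  have hmono : Monotone fun n ↦ F^[n] ⁻¹' V := by
    refine monotone_nat_of_le_succ fun n x hx ↦ ?_
    rw [mem_preimage, Function.iterate_succ_apply']
    exact hFV hx
  have hopen : ∀ n, IsOpen (F^[n] ⁻¹' V) := fun n ↦ hV.preimage (hlhn n).continuous
  have : PathConnectedSpace X := pathConnectedSpace_iff_connectedSpace.2 inferInstance
  -- A path joining two points of the sublevel may rise above `c`, but by compactness it stays in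
  -- one `F^[n] ⁻¹' V`, where the covering of the annulus replaces it by a connected set below `c`.
  have hconn : ∀ c : ℝ, IsPreconnected {x | τ x < c} := by
    intro c
    refine isPreconnected_of_forall_pair fun x hx y hy ↦ ?_
    obtain ⟨γ⟩ := PathConnectedSpace.joined x y
    obtain ⟨n, hn⟩ : ∃ n, range γ ⊆ F^[n] ⁻¹' V := by
      refine (isCompact_range γ.continuous).elim_directed_cover _ hopen ?_ hmono.directed_le
      intro z _
      obtain ⟨n, hn⟩ := habs z
      exact mem_iUnion.2 ⟨n, hn⟩
    have hx' : x ∈ F^[n] ⁻¹' V := hn ⟨0, γ.source⟩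
    have hy' : y ∈ F^[n] ⁻¹' V := hn ⟨1, γ.target⟩
    have hj : Joined (⟨x, hx'⟩ : F^[n] ⁻¹' V) ⟨y, hy'⟩ :=
      ⟨⟨⟨fun t ↦ ⟨γ t, hn ⟨t, rfl⟩⟩, by fun_prop⟩, by simp, by simp⟩⟩
    obtain ⟨t, ht, hxt, hyt, htc⟩ := exists_isPreconnected_of_joined (hp n) hj (c := c - n)
      (by rw [hp2]; exact sub_lt_sub_right hx _) (by rw [hp2]; exact sub_lt_sub_right hy _)
    refine ⟨(↑) '' t, ?_, ⟨_, hxt, rfl⟩, ⟨_, hyt, rfl⟩,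
      ht.image _ continuous_subtype_val.continuousOn⟩
    rintro _ ⟨z, hz, rfl⟩
    have := htc z hz
    rw [hp2] at this
    exact (sub_lt_sub_iff_right _).1 this
  have hVeq : V = {x | τ x < 0} :=
    eq_sublevel_of_isPreconnected hτ hV e (fun x ↦ (hτV x).symm) (hconn 0)
  have hpre : ∀ n : ℕ, F^[n] ⁻¹' V = {x | τ x < n} := fun n ↦ by
    ext x
    rw [hVeq, mem_preimage, mem_ofPred, mem_ofPred, hτF, sub_neg]
  have : ContractibleSpace (Iio (0 : ℝ)) := (convex_Iio 0).contractibleSpace ⟨-1, by simp⟩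
  have : LocallyPathConnectedSpace (Iio (0 : ℝ)) := isOpen_Iio.locallyPathConnectedSpace
  have hchart : ∀ n : ℕ, Nonempty (CircleChart τ n) := by
    intro n
    have hpc : IsPathConnected (F^[n] ⁻¹' V) := by
      refine (hopen n).isConnected_iff_isPathConnected.1 ⟨?_, hpre n ▸ hconn n⟩
      let x : V := e.symm (⟨-1, by simp⟩, 1)
      exact ⟨x, hFV.iterate n x.2⟩
    have := isPathConnected_iff_pathConnectedSpace.1 hpc
    obtain ⟨g, hg⟩ := exists_homeomorph_circle_prod_of_isCoveringMap (hp n) (hpfin n)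
    exact nonempty_circleChart_of_homeomorph (hpre n) g fun x ↦ by rw [hg, hp2]
  exact exists_homeomorph_of_circleChart hτ fun n ↦ (hchart n).some

end Dynamics

/-! ### Attractors of strictly attracting sets. -/

theorem attractor_subset {M : Type*} {f : M → M} {U : Set M} : attractor f U ⊆ U := fun x hx ↦ by
  simpa using mem_iInter.1 hx 0

section Attractors

variable {M : Type*} [TopologicalSpace M] {f : M → M} {U W : Set M}

/-- This interlacing lets the images of `closure U`, compact when `M` is, replace those of `U` in
the attractor. -/
theorem IsStrictlyAttracting.iterate_image_closure_subset (hU : IsStrictlyAttracting f U) (n : ℕ) :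
    f^[n + 1] '' closure U ⊆ f^[n] '' U := by
  rw [Function.iterate_succ, image_comp]
  exact image_mono hU.2

/-- A compact strictly attracting set is attracted into every neighborhood of its attractor, in a
finite time. -/
theorem IsStrictlyAttracting.exists_iterate_image_subset [T2Space M] [CompactSpace M]
    (hf : Continuous f) (hU : IsStrictlyAttracting f U) (hW : IsOpen W)
    (hUW : attractor f U ⊆ W) : ∃ n, f^[n] '' U ⊆ W := by
  have hcomp : ∀ n, IsCompact (f^[n] '' closure U) := fun n ↦
    isClosed_closure.isCompact.image (hf.iterate n)
  have hanti : Antitone fun n ↦ f^[n] '' closure U := antitone_nat_of_succ_le fun n ↦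
    (hU.iterate_image_closure_subset n).trans (image_mono subset_closure)
  obtain ⟨n, hn⟩ := exists_subset_nhds_of_isCompact (V := fun n ↦ f^[n] '' closure U)
    hanti.directed_ge hcomp (U := W) fun x hx ↦
    hW.mem_nhds (hUW (mem_iInter.2 fun n ↦
      hU.iterate_image_closure_subset n (mem_iInter.1 hx (n + 1))))
  exact ⟨n, (image_mono subset_closure).trans hn⟩

theorem IsStrictlyAttracting.isClosed_attractor [T2Space M] [CompactSpace M]
    (hf : Continuous f) (hU : IsStrictlyAttracting f U) : IsClosed (attractor f U) := by
  have h : attractor f U = ⋂ n, f^[n] '' closure U :=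
    (iInter_mono fun n ↦ image_mono subset_closure).antisymm fun x hx ↦
      mem_iInter.2 fun n ↦ hU.iterate_image_closure_subset n (mem_iInter.1 hx (n + 1))
  rw [h]
  exact isClosed_iInter fun n ↦ (isClosed_closure.isCompact.image (hf.iterate n)).isClosed

end Attractors

end InnerDynamics

/-! ### Restriction of the dynamics to `S`. -/

open Set InnerDynamics in
theorem mainTheorem2 {M : Type*} [TopologicalSpace M] [T2Space M] [CompactSpace M]
    [ChartedSpace (EuclideanSpace ℝ (Fin 2)) M]
    (f : M → M) (hf : InnerDynamics.IsInnerMapping f)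
    (S : Set M) (hS : InnerDynamics.IsPseudoBottcher f S)
    (hsing : Disjoint S (InnerDynamics.singularSet f)) :
    Nonempty (S ≃ₜ InnerDynamics.openAnnulus) := by
  obtain ⟨U, hU, hSU, hSconn, hSinv, U₀, hU₀, hA, -, -, τ₀, hτ₀⟩ := hS
  obtain ⟨e, he⟩ := hτ₀.trivial_bundle
  have hVo : IsOpen (U₀ \ attractor f U) := hU₀.1.sdiff (hU.isClosed_attractor hf.continuous)
  have hVf : ∀ x ∈ U₀ \ attractor f U, ∀ n, f^[n] x ∈ U₀ \ attractor f U := fun x hx n ↦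
    (hτ₀.shift ⟨x, hx⟩ n).1
  have hSf : ∀ x, f x ∈ S ↔ x ∈ S := fun x ↦ by
    conv_rhs => rw [← hSinv]
    rfl
  have hSfn : ∀ n x, f^[n] x ∈ S ↔ x ∈ S := fun n ↦ by
    induction n with
    | zero => simp
    | succ n ih => intro x; rw [Function.iterate_succ_apply, ih, hSf]
  -- `U` is a neighborhood of the common attractor, so iterates of `U₀` enter it; forward invariance
  -- of `V₀` keeps its orbits off the attractor.
  have hVS : U₀ \ attractor f U ⊆ S := by
    intro x hx
    obtain ⟨n, hn⟩ := hU₀.exists_iterate_image_subset hf.continuous hU.1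
      (hA ▸ attractor_subset)
    rw [hSU]
    refine ⟨mem_iUnion.2 ⟨n, hn (mem_image_of_mem _ hx.1)⟩, fun h ↦ ?_⟩
    obtain ⟨m, hm⟩ := mem_iUnion.1 h
    exact (hVf x hx m).2 hm
  have habs : ∀ x ∈ S, ∃ n, f^[n] x ∈ U₀ \ attractor f U := by
    intro x hx
    obtain ⟨n, hn⟩ := hU.exists_iterate_image_subset hf.continuous hU₀.1
      (hA ▸ attractor_subset)
    rw [hSU] at hx
    obtain ⟨m, hm⟩ := mem_iUnion.1 hx.1
    refine ⟨n + m, ?_, fun h ↦ hx.2 (mem_iUnion.2 ⟨n + m, h⟩)⟩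
    rw [Function.iterate_add_apply]
    exact hn (mem_image_of_mem _ hm)
  -- The definition of `S` removes an infinite union of closed sets, so openness comes from
  -- absorption into `V₀`.
  have hSo : IsOpen S := by
    have : S = ⋃ n, f^[n] ⁻¹' (U₀ \ attractor f U) := by
      ext x
      exact ⟨fun hx ↦ mem_iUnion.2 (habs x hx), fun hx ↦ by
        obtain ⟨n, hn⟩ := mem_iUnion.1 hx
        exact (hSfn n x).1 (hVS hn)⟩
    rw [this]
    exact isOpen_iUnion fun n ↦ hVo.preimage (hf.continuous.iterate n)
  have : LocallyPathConnectedSpace M :=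
    ChartedSpace.locallyPathConnectedSpace (EuclideanSpace ℝ (Fin 2)) M
  have : LocallyPathConnectedSpace S := hSo.locallyPathConnectedSpace
  have : ConnectedSpace S := isConnected_iff_connectedSpace.1 hSconn
  have hmaps : MapsTo f S S := fun x hx ↦ (hSf x).2 hx
  have hiter : ∀ n (x : S), ((hmaps.restrict f S S)^[n] x : M) = f^[n] x := fun n ↦ by
    induction n with
    | zero => exact fun x ↦ rfl
    | succ n ih => exact fun x ↦ ih (hmaps.restrict f S S x)
  have hlhS : IsLocalHomeomorphOn f S := fun x hx ↦ by
    have := disjoint_left.1 hsing hx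
    simp only [singularSet, mem_ofPred, not_not] at this
    exact this x rfl
  -- Total invariance makes this the restriction of a closed map to a full preimage.
  have hcl : IsClosedMap (hmaps.restrict f S S) :=
    (hf.continuous.isClosedMap.restrictPreimage S).comp (Homeomorph.setCongr hSinv.symm).isClosedMap
  have hlh : IsLocalHomeomorph (hmaps.restrict f S S) := by
    have hval : IsLocalHomeomorph ((↑) : S → M) := hSo.isOpenEmbedding_subtypeVal.isLocalHomeomorph
    refine IsLocalHomeomorph.of_comp (g := ((↑) : S → M)) ?_ hval
      ((hf.continuous.comp continuous_subtype_val).subtype_mk _)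
    rw [isLocalHomeomorph_iff_isLocalHomeomorphOn_univ] at hval ⊢
    exact hlhS.comp hval fun x _ ↦ x.2
  have hfin : ∀ x, (hmaps.restrict f S S ⁻¹' {x}).Finite := by
    intro x
    have h := ((isClosed_singleton (x := (x : M))).preimage hf.continuous).isCompact.finite
      (hf.discrete x)
    refine (h.preimage Subtype.val_injective.injOn).subset ?_
    rintro y rfl
    rfl
  let V : Set S := (↑) ⁻¹' (U₀ \ attractor f U)
  have hFV : MapsTo (hmaps.restrict f S S) V V := fun x hx ↦ hVf x hx 1
  let e' : V ≃ₜ ↥(U₀ \ attractor f U) :=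
    { toFun := fun x ↦ ⟨x.1.1, x.2⟩
      invFun := fun y ↦ ⟨⟨y.1, hVS y.2⟩, y.2⟩
      left_inv := fun x ↦ rfl
      right_inv := fun y ↦ rfl
      continuous_toFun := by fun_prop
      continuous_invFun := by fun_prop }
  obtain ⟨g⟩ := nonempty_homeomorph_cylinder hcl hlh hfin
    (hVo.preimage continuous_subtype_val : IsOpen V) hFV
    (fun x ↦ (habs x x.2).imp fun n hn ↦ show _ ∈ U₀ \ attractor f U by rwa [hiter])
    (e'.trans e) fun x ↦ by
      obtain ⟨h, h'⟩ := hτ₀.shift (e' x) 1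
      simp only [Homeomorph.trans_apply, he]
      rw [Nat.cast_one] at h'
      exact h'
  obtain ⟨g'⟩ := nonempty_circle_prod_real_homeomorph_openAnnulus
  exact ⟨g.trans g'⟩
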